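/- For a real matrix $\Phi$ with $N$ columns, $v\in\mathbb{R}^N$ and $T\subseteq\{1,\dots,N\}$, let $v_T$ be the vector that agrees with $v$ on $T$ and vanishes on the complement $T^c$. We say that - $\Phi$ has the $s$-null space property ($s$-NSP) if $\|v_T\|_1<\|v_{T^c}\|_1$ for all $v\in\ker\Phi\setminus\{0\}$ and all $|T|\le s$; - $\Phi$ has $(s,\gamma)$-NSP if $\|v_T\|_1\le\gamma\|v_{T^c}\|_1$ for all $v\in\ker\Phi$ and all $|T|\le s$; - $\Phi$ has RIP of sparsity $k$ with constant $\delta$ if $(1-\delta)\|v\|_2^2\le\|\Phi v\|_2^2\le(1+\delta)\|v\|_2^2$ for all $v\in\mathbb{R}^N$ with at most $k$ nonzero entries; - $\Phi$ has $k$-RIP-NSP with constant $\delta$ if there is a real matrix $A$ with $\ker A=\ker\Phi$ that has RIP of sparsity $k$ with constant $\delta$. **Theorem.** (1) There is an absolute constant $K>0$ such that, with $C(\gamma)=K\left(\frac{\sqrt2+\gamma}{\gamma}\right)^2$, the following holds. Let $0<\gamma<1$ and $0\le\delta_{2s}<\frac1{\sqrt2}$. If the natural numbers $M,N,s$ satisfy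 $$\frac N2\ge M\ge 2\,C(\gamma/3)\,s\log^4N,\qquad \frac Ns\ge 11,\qquad s\ge\frac{640(1+\delta_{2s})^2}{(1-\sqrt2\,\delta_{2s})^2\gamma^2},$$ then there is a matrix $\Phi\in\mathbb{R}^{M\times N}$ that has $(s,\gamma)$-NSP but does not have $2s$-RIP-NSP with constant $\delta_{2s}$. (2) Conversely, for all natural numbers $M,N,s$ and all $0\le\delta_{2s}<\frac1{\sqrt2}$, every matrix $\Phi\in\mathbb{R}^{M\times N}$ that has $2s$-RIP-NSP with constant $\delta_{2s}$ has $s$-NSP. Hence RIP-NSP is strictly stronger than NSP. -/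

import Mathlib

namespace CompressedSensing

/-- The null space of `Φ ∈ ℝ^{m × N}`, as a subspace of `ℝ^N`. -/
def nullSpace {m N : ℕ} (Φ : Matrix (Fin m) (Fin N) ℝ) : Submodule ℝ (Fin N → ℝ) :=
  LinearMap.ker Φ.mulVecLin

/-- The `ℓ¹` norm `‖v_T‖₁` of the restriction of `v` to the index set `T`. -/
def l1On {N : ℕ} (T : Finset (Fin N)) (v : Fin N → ℝ) : ℝ := ∑ i ∈ T, |v i|

/-- The squared Euclidean norm `‖v‖₂²`. -/
def l2Sq {n : ℕ} (v : Fin n → ℝ) : ℝ := ∑ i, v i ^ 2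

/-- `Σ_k`: the vectors of `ℝ^N` with at most `k` nonzero entries. -/
def sparseVectors (N k : ℕ) : Set (Fin N → ℝ) :=
  {v | (Finset.univ.filter fun i => v i ≠ 0).card ≤ k}

/-- The `s`-null space property: `‖v_T‖₁ < ‖v_{Tᶜ}‖₁` for all nonzero `v ∈ ker Φ`, `|T| ≤ s`. -/
def HasNSP {m N : ℕ} (Φ : Matrix (Fin m) (Fin N) ℝ) (s : ℕ) : Prop :=
  ∀ v ∈ nullSpace Φ, v ≠ 0 → ∀ T : Finset (Fin N), T.card ≤ s → l1On T v < l1On Tᶜ v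

/-- The `(s, γ)`-null space property: `‖v_T‖₁ ≤ γ ‖v_{Tᶜ}‖₁` for all `v ∈ ker Φ`, `|T| ≤ s`. -/
def HasNSPWith {m N : ℕ} (Φ : Matrix (Fin m) (Fin N) ℝ) (s : ℕ) (γ : ℝ) : Prop :=
  ∀ v ∈ nullSpace Φ, ∀ T : Finset (Fin N), T.card ≤ s → l1On T v ≤ γ * l1On Tᶜ v

/-- The restricted isometry property of sparsity `k` with constant `δ`. -/
def HasRIP {m N : ℕ} (A : Matrix (Fin m) (Fin N) ℝ) (k : ℕ) (δ : ℝ) : Prop :=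
  ∀ v ∈ sparseVectors N k,
    (1 - δ) * l2Sq v ≤ l2Sq (A.mulVec v) ∧ l2Sq (A.mulVec v) ≤ (1 + δ) * l2Sq v

/-- `Φ` has `k`-RIP-NSP with constant `δ`: it has the same null space as some real matrix (with
any number of rows) that has RIP of sparsity `k` with constant `δ`. -/
def HasRIPNSP {m N : ℕ} (Φ : Matrix (Fin m) (Fin N) ℝ) (k : ℕ) (δ : ℝ) : Prop :=
  ∃ (p : ℕ) (A : Matrix (Fin p) (Fin N) ℝ), nullSpace A = nullSpace Φ ∧ HasRIP A k δ

/-- The function `C(γ) = K ((√2 + γ) / γ)²`; `K` is going to be an absolute constant. -/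
noncomputable def measurementConst (K γ : ℝ) : ℝ := K * ((√2 + γ) / γ) ^ 2

end CompressedSensing

namespace CompressedSensing

/-! Both halves rest on one estimate, `HasRIP.exists_tail_energy`. A kernel vector is split into a
head on `T` and a flat tail; the tail is a convex combination of `s`-sparse vectors, so some such
`u` correlates with the head under `A` at least as negatively as the tail does. RIP on two
combinations of head and `u` then compares their energies, with a free parameter `μ`. Choosing `μ =
√2 - 1` makes `δ < 1/√2` contradict a failure of NSP; choosing `μ = 1/2` shows that a single entry
of a kernel vector is at most of order `1/√s` times the `ℓ¹` norm of the rest.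

NSP imposes no such decay, and this gives the separation. A random sign matrix has a kernel with
`‖x‖₂ ≤ ρ‖x‖₁`, where `ρ = γ/(10√s)`: a violating `x` would be close to one of the `(2N)^k` means of
`k` signed basis vectors, nearly annihilated by the matrix, and a union bound excludes this. Hence
`s` entries carry at most `γ/10` of the `ℓ¹` mass. Stretching one coordinate of this kernel until
its share is about `γ/2` preserves `(s,γ)`-NSP but leaves an entry too dominant for RIP-NSP once `s
γ² ≥ 640`. -/

/-! ### Sparse representation of a polytope -/

/-- Induction on the number of coordinates strictly between `0` and `1`: with two of them, shifting
mass either way until one becomes integral writes `w` as a convex combination of simpler points. -/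
theorem mem_convexHull_sparse_of_mem_Icc {ι : Type*} [Fintype ι] [DecidableEq ι] (s : ℕ)
    (w : ι → ℝ) (h0 : ∀ j, 0 ≤ w j) (h1 : ∀ j, w j ≤ 1) (hs : ∑ j, w j ≤ s) :
    w ∈ convexHull ℝ {u : ι → ℝ | (∀ j, 0 ≤ u j ∧ u j ≤ 1) ∧
      (Finset.univ.filter fun j => u j ≠ 0).card ≤ s ∧ ∀ j, w j = 0 → u j = 0} := by
  induction hn : (Finset.univ.filter fun j => 0 < w j ∧ w j < 1).card using
    Nat.strong_induction_on generalizing w with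
  | _ n ih =>
  by_cases hF : (Finset.univ.filter fun j => 0 < w j ∧ w j < 1).card ≤ 1
  · refine subset_convexHull ℝ _ ⟨fun j => ⟨h0 j, h1 j⟩, ?_, fun j hj => hj⟩
    set F := Finset.univ.filter fun j => 0 < w j ∧ w j < 1 with hFdef
    set G := Finset.univ.filter fun j => w j = 1 with hGdef
    have hsub : (Finset.univ.filter fun j => w j ≠ 0) ⊆ F ∪ G := by
      intro j hj
      simp only [Finset.mem_filter, Finset.mem_univ, true_and, Finset.mem_union, hFdef,
        hGdef] at hj ⊢
      rcases (h1 j).lt_or_eq with h | h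
      · exact Or.inl ⟨lt_of_le_of_ne (h0 j) (Ne.symm hj), h⟩
      · exact Or.inr h
    have hdisj : Disjoint F G := by
      rw [Finset.disjoint_left]
      intro j hj hj'
      simp only [Finset.mem_filter, Finset.mem_univ, true_and, hFdef, hGdef] at hj hj'
      linarith [hj.2]
    have hsum : ∑ j ∈ F, w j + (G.card : ℝ) ≤ s := by
      have hG : ∑ j ∈ G, w j = G.card := by
        rw [Finset.sum_congr rfl (g := fun _ => (1 : ℝ))]
        · simp
        · intro j hj
          simpa [hGdef] using hj
      rw [← hG, ← Finset.sum_union hdisj]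
      exact (Finset.sum_le_univ_sum_of_nonneg h0).trans hs
    refine (Finset.card_le_card hsub).trans ?_
    rw [Finset.card_union_of_disjoint hdisj]
    rcases Nat.le_one_iff_eq_zero_or_eq_one.mp hF with h | h
    · rw [Finset.card_eq_zero] at h
      rw [h] at hsum ⊢
      simp only [Finset.sum_empty, zero_add] at hsum
      simpa using (by exact_mod_cast hsum : G.card ≤ s)
    · obtain ⟨j, hj⟩ := Finset.card_eq_one.mp h
      have hjF : j ∈ F := by simp [hj]
      have hj0 : 0 < w j := by
        have := (Finset.mem_filter.mp hjF).2.1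
        exact this
      rw [hj, Finset.sum_singleton] at hsum
      -- The one fractional entry makes the inequality strict, and integrality leaves room for it in
      -- the support.
      have : (G.card : ℝ) < s := by linarith
      have : G.card < s := by exact_mod_cast this
      omega
  · push Not at hF
    obtain ⟨j, hj, k, hk, hjk⟩ := Finset.one_lt_card.mp hF
    simp only [Finset.mem_filter, Finset.mem_univ, true_and] at hj hk
    -- The largest admissible transfer from `k` to `j`; it makes one of the two integral and fixes
    -- the zeros of `w`.
    have key : ∀ j k : ι, j ≠ k → 0 < w j → w j < 1 → 0 < w k → w k < 1 →
        w + (min (1 - w j) (w k)) • (Pi.single j 1 - Pi.single k 1 : ι → ℝ) ∈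
        convexHull ℝ {u : ι → ℝ | (∀ j, 0 ≤ u j ∧ u j ≤ 1) ∧
      (Finset.univ.filter fun j => u j ≠ 0).card ≤ s ∧ ∀ j, w j = 0 → u j = 0} := by
      intro j k hjk hj0 hj1 hk0 hk1
      set t := min (1 - w j) (w k) with ht
      set w' : ι → ℝ := w + t • (Pi.single j 1 - Pi.single k 1 : ι → ℝ) with hw'
      have ht0 : 0 < t := lt_min (by linarith) hk0
      have htj : t ≤ 1 - w j := min_le_left _ _
      have htk : t ≤ w k := min_le_right _ _
      have e1 : w' j = w j + t := by simp [hw', hjk]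
      have e2 : w' k = w k - t := by simp [hw', hjk.symm]; ring
      have e3 : ∀ l, l ≠ j → l ≠ k → w' l = w l := by
        intro l hl hl'; simp [hw', hl, hl']
      have hz : ∀ l, w l = 0 → w' l = 0 := by
        intro l hl
        rw [e3 l (by rintro rfl; linarith) (by rintro rfl; linarith), hl]
      have hb : ∀ l, 0 ≤ w' l ∧ w' l ≤ 1 := by
        intro l
        by_cases hlj : l = j
        · subst hlj; rw [e1]; constructor <;> linarith
        by_cases hlk : l = k
        · subst hlk; rw [e2]; constructor <;> linarith
        · rw [e3 l hlj hlk]; exact ⟨h0 l, h1 l⟩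
      have hsum' : ∑ l, w' l = ∑ l, w l := by
        simp [hw', Finset.sum_add_distrib, ← Finset.mul_sum]
      have hlt : (Finset.univ.filter fun l => 0 < w' l ∧ w' l < 1).card < n := by
        rw [← hn]
        refine Finset.card_lt_card ⟨?_, ?_⟩
        · intro l hl
          simp only [Finset.mem_filter, Finset.mem_univ, true_and] at hl ⊢
          by_cases hlj : l = j
          · subst hlj; exact ⟨hj0, hj1⟩
          by_cases hlk : l = k
          · subst hlk; exact ⟨hk0, hk1⟩
          · rwa [e3 l hlj hlk] at hl
        · intro hsub
          have a1 := hsub (Finset.mem_filter.mpr ⟨Finset.mem_univ j, hj0, hj1⟩)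
          have a2 := hsub (Finset.mem_filter.mpr ⟨Finset.mem_univ k, hk0, hk1⟩)
          simp only [Finset.mem_filter, Finset.mem_univ, true_and, e1, e2] at a1 a2
          rcases min_choice (1 - w j) (w k) with h | h <;> rw [← ht] at h <;> linarith [a1.2, a2.1]
      refine convexHull_mono ?_ (ih _ hlt w' (fun l => (hb l).1) (fun l => (hb l).2)
        (hsum'.le.trans hs) rfl)
      rintro u ⟨hu1, hu2, hu3⟩
      exact ⟨hu1, hu2, fun l hl => hu3 l (hz l hl)⟩
    have hp := key j k hjk hj.1 hj.2 hk.1 hk.2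
    have hm := key k j hjk.symm hk.1 hk.2 hj.1 hj.2
    set t₁ := min (1 - w j) (w k)
    set t₂ := min (1 - w k) (w j)
    have ht₁ : 0 < t₁ := lt_min (by linarith [hj.2]) hk.1
    have ht₂ : 0 < t₂ := lt_min (by linarith [hk.2]) hj.1
    have hne : t₁ + t₂ ≠ 0 := by positivity
    have := (convex_convexHull ℝ _) hp hm (a := t₂ / (t₁ + t₂)) (b := t₁ / (t₁ + t₂))
      (by positivity) (by positivity) (by field_simp; ring)
    convert this using 1
    ext l
    simp only [Pi.add_apply, Pi.smul_apply, Pi.sub_apply, smul_eq_mul]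
    field_simp
    ring

theorem mem_convexHull_sparse {ι : Type*} [Fintype ι] [DecidableEq ι] (s : ℕ) (α : ℝ)
    (v : ι → ℝ) (h : ∀ j, |v j| ≤ α) (hs : ∑ j, |v j| ≤ s * α) :
    v ∈ convexHull ℝ {u : ι → ℝ | (∀ j, |u j| ≤ α) ∧
      (Finset.univ.filter fun j => u j ≠ 0).card ≤ s ∧ ∀ j, v j = 0 → u j = 0} := by
  by_cases hv : ∀ j, v j = 0
  · refine subset_convexHull ℝ _ ⟨h, ?_, fun j hj => hj⟩
    simp [hv]
  push Not at hv
  obtain ⟨j₀, hj₀⟩ := hv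
  have hα : 0 < α := (abs_pos.mpr hj₀).trans_le (h j₀)
  have hw := mem_convexHull_sparse_of_mem_Icc s (fun j => |v j| / α)
    (fun j => by positivity) (fun j => (div_le_one hα).mpr (h j))
    (by rw [← Finset.sum_div, div_le_iff₀ hα]; exact hs)
  -- Restores scale and signs, carrying the cube version to the symmetric one.
  let L : (ι → ℝ) →ₗ[ℝ] (ι → ℝ) :=
    LinearMap.pi fun j => (α * (SignType.sign (v j) : ℝ)) • LinearMap.proj j
  have hLa : ∀ u j, L u j = α * (SignType.sign (v j) : ℝ) * u j := fun u j => by simp [L]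
  have hsign : ∀ x : ℝ, |(SignType.sign x : ℝ)| ≤ 1 := by
    intro x
    rcases lt_trichotomy x 0 with hx | hx | hx <;> simp [hx]
  have hLv : L (fun j => |v j| / α) = v := by
    ext j
    rw [hLa]
    field_simp
    exact sign_mul_abs (v j)
  have := Set.mem_image_of_mem L hw
  rw [hLv, LinearMap.image_convexHull] at this
  refine convexHull_mono ?_ this
  rintro _ ⟨u, ⟨hu1, hu2, hu3⟩, rfl⟩
  refine ⟨fun j => ?_, (Finset.card_le_card ?_).trans hu2, fun j hj => ?_⟩
  · rw [hLa, abs_mul, abs_mul, abs_of_pos hα, abs_of_nonneg (hu1 j).1]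
    have := hsign (v j)
    calc α * |(SignType.sign (v j) : ℝ)| * u j ≤ α * 1 * 1 := by
          gcongr
          · exact (hu1 j).1
          · exact (hu1 j).2
      _ = α := by ring
  · intro j hj
    simp only [Finset.mem_filter, Finset.mem_univ, true_and, hLa] at hj ⊢
    exact right_ne_zero_of_mul hj
  · rw [hLa, hj]; simp

/-! ### RIP and kernel vectors -/

/-- The restriction `v_T`. -/
noncomputable def restrict {N : ℕ} (T : Finset (Fin N)) (v : Fin N → ℝ) : Fin N → ℝ :=
  fun j => if j ∈ T then v j else 0

theorem l2Sq_nonneg {n : ℕ} (v : Fin n → ℝ) : 0 ≤ l2Sq v :=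
  Finset.sum_nonneg fun _ _ => sq_nonneg _

theorem l2Sq_eq_dotProduct {n : ℕ} (v : Fin n → ℝ) : l2Sq v = v ⬝ᵥ v := by
  simp [l2Sq, dotProduct, sq]

theorem l2Sq_linear_comb {n : ℕ} (a b : ℝ) (x y : Fin n → ℝ) :
    l2Sq (a • x + b • y) = a ^ 2 * l2Sq x + 2 * a * b * (x ⬝ᵥ y) + b ^ 2 * l2Sq y := by
  simp only [l2Sq, dotProduct, Finset.mul_sum, ← Finset.sum_add_distrib]
  refine Finset.sum_congr rfl fun i _ => ?_
  simp only [Pi.add_apply, Pi.smul_apply, smul_eq_mul]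
  ring

theorem restrict_add_restrict_compl {N : ℕ} (T : Finset (Fin N)) (v : Fin N → ℝ) :
    restrict T v + restrict Tᶜ v = v := by
  ext j
  by_cases hj : j ∈ T <;> simp [restrict, hj]

theorem l2Sq_restrict {N : ℕ} (T : Finset (Fin N)) (v : Fin N → ℝ) :
    l2Sq (restrict T v) = ∑ j ∈ T, v j ^ 2 := by
  simp [l2Sq, restrict, ite_pow, Finset.sum_ite_mem]

theorem l1On_add_compl {N : ℕ} (T : Finset (Fin N)) (v : Fin N → ℝ) :
    l1On T v + l1On Tᶜ v = l1On Finset.univ v :=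
  Finset.sum_add_sum_compl T _

theorem l1On_nonneg {N : ℕ} (T : Finset (Fin N)) (v : Fin N → ℝ) : 0 ≤ l1On T v :=
  Finset.sum_nonneg fun _ _ => abs_nonneg _

theorem l1On_mono {N : ℕ} {S T : Finset (Fin N)} (h : S ⊆ T) (v : Fin N → ℝ) :
    l1On S v ≤ l1On T v :=
  Finset.sum_le_sum_of_subset_of_nonneg h fun _ _ _ => abs_nonneg _

theorem l1On_sq_le {N s : ℕ} {T : Finset (Fin N)} (hT : T.card ≤ s) (v : Fin N → ℝ) :
    l1On T v ^ 2 ≤ s * l2Sq (restrict T v) := by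
  have h := sq_sum_le_card_mul_sum_sq (s := T) (f := fun j => |v j|)
  simp only [sq_abs] at h
  rw [l2Sq_restrict, l1On]
  refine h.trans ?_
  have : (T.card : ℝ) ≤ s := by exact_mod_cast hT
  exact mul_le_mul_of_nonneg_right this (Finset.sum_nonneg fun _ _ => sq_nonneg _)

theorem mem_nullSpace {m N : ℕ} {A : Matrix (Fin m) (Fin N) ℝ} {v : Fin N → ℝ} :
    v ∈ nullSpace A ↔ A.mulVec v = 0 := by
  simp [nullSpace]

/-- A kernel vector of a matrix with the restricted isometry property, compared on its head `T`
with a sparse vector that carries the whole flat tail. -/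
theorem HasRIP.exists_tail_energy {p N s : ℕ} {A : Matrix (Fin p) (Fin N) ℝ} {δ : ℝ}
    (hA : HasRIP A (2 * s) δ) {h : Fin N → ℝ} (hh : h ∈ nullSpace A) {T : Finset (Fin N)}
    (hT : T.card ≤ s) {α : ℝ} (hα0 : 0 ≤ α) (hα : ∀ j ∉ T, |h j| ≤ α)
    (h1 : l1On Tᶜ h ≤ s * α) :
    ∃ U : ℝ, 0 ≤ U ∧ U ≤ s * α ^ 2 ∧ ∀ μ : ℝ, 0 ≤ μ → μ ≤ 1 →
      (1 - δ) / 4 * (l2Sq (restrict T h) + μ ^ 2 * U) ≤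
        (1 + δ) * ((1 / 2 - μ) ^ 2 * l2Sq (restrict T h) + μ ^ 2 / 4 * U) := by
  set x := restrict T h with hx
  have hmem := mem_convexHull_sparse s α (restrict Tᶜ h)
    (fun j => by
      by_cases hj : j ∈ T
      · simpa [restrict, hj] using hα0
      · simpa [restrict, hj] using hα j hj)
    (by
      refine le_trans (le_of_eq ?_) h1
      simp [restrict, l1On, apply_ite abs, Finset.sum_ite, Finset.filter_not, Finset.compl_eq_univ_sdiff])
  have hAx : A.mulVec (restrict Tᶜ h) = - A.mulVec x := by
    have := mem_nullSpace.mp hh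
    rw [← restrict_add_restrict_compl T h, Matrix.mulVec_add] at this
    exact eq_neg_of_add_eq_zero_right this
  -- A linear functional on a convex hull does not exceed its value at a point at every generator;
  -- at the tail, `⟨Ax, A·⟩` equals `-‖Ax‖²`.
  obtain ⟨u, ⟨hu1, hu2, hu3⟩, hu4⟩ : ∃ u ∈ {u : Fin N → ℝ | (∀ j, |u j| ≤ α) ∧
      (Finset.univ.filter fun j => u j ≠ 0).card ≤ s ∧ ∀ j, restrict Tᶜ h j = 0 → u j = 0},
      A.mulVec x ⬝ᵥ A.mulVec u ≤ - l2Sq (A.mulVec x) := by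
    by_contra! hcon
    have hconv : Convex ℝ {u : Fin N → ℝ | - l2Sq (A.mulVec x) < A.mulVec x ⬝ᵥ A.mulVec u} :=
      convex_halfSpace_gt ⟨fun a b => by simp [Matrix.mulVec_add, dotProduct_add],
        fun c a => by simp [Matrix.mulVec_smul, dotProduct_smul]⟩ _
    have : - l2Sq (A.mulVec x) < A.mulVec x ⬝ᵥ A.mulVec (restrict Tᶜ h) :=
      convexHull_min hcon hconv hmem
    rw [hAx, dotProduct_neg, ← l2Sq_eq_dotProduct] at this
    exact lt_irrefl _ this
  have huT : ∀ j ∈ T, u j = 0 := fun j hj => hu3 j (by simp [restrict, hj])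
  have horth : x ⬝ᵥ u = 0 := by
    refine Finset.sum_eq_zero fun j _ => ?_
    by_cases hj : j ∈ T
    · simp [huT j hj]
    · simp [hx, restrict, hj]
  refine ⟨l2Sq u, l2Sq_nonneg u, ?_, fun μ hμ0 hμ1 => ?_⟩
  · rw [l2Sq, ← Finset.sum_filter_of_ne (p := fun j => u j ≠ 0)
      (fun j _ hj => by simpa using hj)]
    refine (Finset.sum_le_card_nsmul _ _ (α ^ 2) fun j _ => ?_).trans ?_
    · rw [← sq_abs]
      exact pow_le_pow_left₀ (abs_nonneg _) (hu1 j) 2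
    · rw [nsmul_eq_mul]
      gcongr
  · have hsparse : ∀ a b : ℝ, a • x + b • u ∈ sparseVectors N (2 * s) := by
      intro a b
      have : (Finset.univ.filter fun j => (a • x + b • u) j ≠ 0) ⊆
          T ∪ Finset.univ.filter fun j => u j ≠ 0 := by
        intro j hj
        by_contra hcon
        simp only [Finset.mem_union, Finset.mem_filter, Finset.mem_univ, true_and, not_or,
          not_not] at hcon hj
        simp [hx, restrict, hcon.1, hcon.2] at hj
      have h2 := (Finset.card_le_card this).trans (Finset.card_union_le _ _)
      simp only [sparseVectors, Set.mem_ofPred_eq]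
      omega
    -- The two test vectors are tuned so that `r2 - r1/4` cancels `‖Au‖²` and leaves `μ(1-μ)(-‖Ax‖²
    -- - ⟨Ax, Au⟩) ≥ 0`.
    have r1 := (hA _ (hsparse 1 μ)).1
    have r2 := (hA _ (hsparse (1 / 2 - μ) (-(μ / 2)))).2
    rw [Matrix.mulVec_add, Matrix.mulVec_smul, Matrix.mulVec_smul, l2Sq_linear_comb,
      l2Sq_linear_comb, horth] at r1 r2
    have : 0 ≤ μ * (1 - μ) * (- l2Sq (A.mulVec x) - A.mulVec x ⬝ᵥ A.mulVec u) :=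
      mul_nonneg (mul_nonneg hμ0 (by linarith)) (by linarith)
    nlinarith

/-- A set of `k` largest entries of `v` within `S`. -/
theorem exists_top_entries {N : ℕ} (S : Finset (Fin N)) (k : ℕ) (v : Fin N → ℝ) :
    ∃ T ⊆ S, T.card ≤ k ∧ (∀ T' ⊆ S, T'.card ≤ k → l1On T' v ≤ l1On T v) ∧
      ∀ j ∈ S, j ∉ T → k * |v j| ≤ l1On T v := by
  obtain ⟨T, hT, hmax⟩ := Finset.exists_max_image (S.powerset.filter fun T => T.card ≤ k)
    (fun T => l1On T v) ⟨∅, by simp⟩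
  simp only [Finset.mem_filter, Finset.mem_powerset, and_imp] at hT hmax
  refine ⟨T, hT.1, hT.2, hmax, fun j hjS hjT => ?_⟩
  rcases hT.2.lt_or_eq with hlt | heq
  · have := hmax (insert j T) (Finset.insert_subset hjS hT.1)
      (by rw [Finset.card_insert_of_notMem hjT]; omega)
    rw [l1On, Finset.sum_insert hjT, ← l1On] at this
    have h0 : |v j| = 0 := le_antisymm (by linarith) (abs_nonneg _)
    rw [h0, mul_zero]
    exact l1On_nonneg _ _
  · have hle : ∀ i ∈ T, |v j| ≤ |v i| := by
      intro i hi
      have hj' : j ∉ T.erase i := fun hj => hjT (Finset.mem_of_mem_erase hj)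
      have := hmax (insert j (T.erase i))
        (Finset.insert_subset hjS ((Finset.erase_subset _ _).trans hT.1))
        (by
          rw [Finset.card_insert_of_notMem hj', Finset.card_erase_of_mem hi]
          have := Finset.card_pos.mpr ⟨i, hi⟩
          omega)
      rw [l1On, l1On, Finset.sum_insert hj', ← Finset.add_sum_erase T _ hi] at this
      linarith
    have := Finset.card_nsmul_le_sum T (fun i => |v i|) _ hle
    rwa [heq, nsmul_eq_mul] at this

theorem l2Sq_restrict_eq_zero {N : ℕ} {T : Finset (Fin N)} {v : Fin N → ℝ}
    (h : l2Sq (restrict T v) = 0) : l1On T v = 0 := by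
  have := l1On_sq_le (le_refl T.card) v
  rw [h, mul_zero] at this
  exact pow_eq_zero_iff (two_ne_zero) |>.mp (le_antisymm this (sq_nonneg _))

/-! ### RIP-NSP implies NSP -/

theorem HasRIPNSP.hasNSP {M N s : ℕ} {Φ : Matrix (Fin M) (Fin N) ℝ} {δ : ℝ} (hδ0 : 0 ≤ δ)
    (hδ : δ < 1 / √2) (hΦ : HasRIPNSP Φ (2 * s) δ) : HasNSP Φ s := by
  obtain ⟨p, A, hker, hA⟩ := hΦ
  intro v hv hv0 T hT
  rw [← hker] at hv
  by_contra! hcon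
  obtain ⟨T', -, hT', hmax, htop⟩ := exists_top_entries Finset.univ s v
  have hle : l1On T v ≤ l1On T' v := hmax T (Finset.subset_univ _) hT
  have hcon' : l1On T'ᶜ v ≤ l1On T' v := by
    have := l1On_add_compl T v
    have := l1On_add_compl T' v
    linarith
  have hpos : 0 < l1On T' v := by
    by_contra! hneg
    apply hv0
    have h0 : l1On Finset.univ v ≤ 0 := by rw [← l1On_add_compl T' v]; linarith
    ext j
    have := (Finset.single_le_sum (f := fun j => |v j|) (fun _ _ => abs_nonneg _)
      (Finset.mem_univ j)).trans h0
    simpa using le_antisymm this (abs_nonneg _)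
  have hs : 0 < s := by
    rcases Nat.eq_zero_or_pos s with rfl | h
    · rw [Finset.card_eq_zero.mp (Nat.le_zero.mp hT')] at hpos
      simp [l1On] at hpos
    · exact h
  have hs' : (0 : ℝ) < s := by exact_mod_cast hs
  obtain ⟨U, hU0, hU, hμ⟩ := hA.exists_tail_energy hv hT' (α := l1On T' v / s) (by positivity)
    (fun j hj => by
      rw [le_div_iff₀ hs', mul_comm]
      exact htop j (Finset.mem_univ _) hj)
    (by rw [mul_div_cancel₀ _ hs'.ne']; exact hcon')
  have hX : 0 < l2Sq (restrict T' v) := by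
    refine lt_of_le_of_ne (l2Sq_nonneg _) fun h => ?_
    rw [l2Sq_restrict_eq_zero h.symm] at hpos
    exact lt_irrefl _ hpos
  have hUX : U ≤ l2Sq (restrict T' v) := by
    refine hU.trans ?_
    have := l1On_sq_le hT' v
    have e : (s : ℝ) * (l1On T' v / s) ^ 2 = l1On T' v ^ 2 / s := by field_simp
    rw [e, div_le_iff₀ hs', mul_comm]
    exact this
  have h2 : √2 ^ 2 = 2 := Real.sq_sqrt (by norm_num)
  have h21 : 1 < √2 := by nlinarith [Real.sqrt_nonneg 2]
  have h22 : √2 < 3 / 2 := by nlinarith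
  -- In the extreme case `U = X`, the optimal `μ` is the positive root of `μ² + 2μ = 1`.
  have key := hμ (√2 - 1) (by linarith) (by linarith)
  rw [lt_div_iff₀ (by positivity)] at hδ
  set X := l2Sq (restrict T' v)
  have e : (√2 - 1) ^ 2 = 3 - 2 * √2 := by linear_combination h2
  have e' : (1 / 2 - (√2 - 1)) ^ 2 = 17 / 4 - 3 * √2 := by linear_combination h2
  rw [e, e'] at key
  have hc : 0 < 3 - 2 * √2 := by linarith
  have k1 : δ * ((3 - 2 * √2) * U) ≤ δ * ((3 - 2 * √2) * X) := by gcongr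
  have k2 : 0 < X * ((1 - δ * √2) * (3 * √2 - 4)) := by
    refine mul_pos hX (mul_pos (by linarith) ?_)
    nlinarith
  have k3 : X * ((1 - δ * √2) * (3 * √2 - 4)) = X * (3 * √2 - 4 - δ * (6 - 4 * √2)) := by
    linear_combination (-3 * X * δ) * h2
  rw [k3] at k2
  linarith


/-! ### Maurey's empirical approximation -/

/-- Greedy, derandomized Maurey argument: each new term is chosen with no larger inner product
against `S - m` than `m` has, so the squared error grows by at most `B`. -/
theorem exists_sum_sub_norm_sq_le {ι E : Type*} [NormedAddCommGroup E] [InnerProductSpace ℝ E]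
    (w : ι → E) (m : E) (hm : m ∈ convexHull ℝ (Set.range w)) (B : ℝ)
    (hB : ∀ j, ‖w j‖ ^ 2 ≤ B) (k : ℕ) :
    ∃ J : Fin k → ι, ‖∑ l, w (J l) - (k : ℝ) • m‖ ^ 2 ≤ k * B := by
  induction k with
  | zero => exact ⟨Fin.elim0, by simp⟩
  | succ k ih =>
    obtain ⟨J, hJ⟩ := ih
    set S := ∑ l, w (J l) - (k : ℝ) • m with hS
    obtain ⟨j, hj⟩ : ∃ j, inner ℝ (S - m) (w j) ≤ inner ℝ (S - m) m := by
      by_contra! hcon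
      have hconv : Convex ℝ {y : E | inner ℝ (S - m) m < inner ℝ (S - m) y} :=
        convex_halfSpace_gt ⟨fun a b => inner_add_right _ _ _,
          fun c a => by simp [inner_smul_right]⟩ _
      have : inner ℝ (S - m) m < inner ℝ (S - m) m :=
        convexHull_min (by rintro _ ⟨j, rfl⟩; exact hcon j) hconv hm
      exact lt_irrefl _ this
    refine ⟨Fin.cons j J, ?_⟩
    have e : ∑ l : Fin (k + 1), w ((Fin.cons j J : Fin (k + 1) → ι) l) - ((k + 1 : ℕ) : ℝ) • m
        = (S - m) + w j := by
      rw [Fin.sum_univ_succ]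
      simp only [Fin.cons_zero, Fin.cons_succ, hS]
      push_cast
      rw [add_smul, one_smul]
      abel
    rw [e, norm_add_sq_real]
    have h1 : ‖S - m‖ ^ 2 + 2 * inner ℝ (S - m) m + ‖m‖ ^ 2 = ‖S‖ ^ 2 := by
      rw [← norm_add_sq_real, sub_add_cancel]
    have := hB j
    push_cast
    nlinarith [sq_nonneg ‖m‖]

/-- The sign `±1` encoded by a Boolean. -/
def boolSign (b : Bool) : ℝ := if b then 1 else -1

theorem boolSign_sq (b : Bool) : boolSign b ^ 2 = 1 := by cases b <;> simp [boolSign]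

theorem exists_boolSign_mul_abs (x : ℝ) : ∃ b, boolSign b * |x| = x := by
  rcases le_total 0 x with h | h
  · exact ⟨true, by simp [boolSign, abs_of_nonneg h]⟩
  · exact ⟨false, by simp [boolSign, abs_of_nonpos h]⟩

/-- The signed standard basis vectors of `ℝ^N`. -/
def signedBasis {N : ℕ} (a : Fin N × Bool) : Fin N → ℝ := Pi.single a.1 (boolSign a.2)

/-- The empirical mean of a family of signed standard basis vectors. -/
noncomputable def signedMean {N k : ℕ} (J : Fin k → Fin N × Bool) : Fin N → ℝ :=
  (k : ℝ)⁻¹ • ∑ l, signedBasis (J l)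

/-- The matrix of signs encoded by a Boolean matrix. -/
def signMatrix {M N : ℕ} (ε : Fin M → Fin N → Bool) : Matrix (Fin M) (Fin N) ℝ :=
  Matrix.of fun i j => boolSign (ε i j)

theorem exists_signedMean_approx {M N k : ℕ} (hk : 0 < k) (ε : Fin M → Fin N → Bool)
    (x : Fin N → ℝ) (hx : (signMatrix ε).mulVec x = 0) (hx1 : l1On Finset.univ x = 1) :
    ∃ J : Fin k → Fin N × Bool,
      M * l2Sq (signedMean J - x) + l2Sq ((signMatrix ε).mulVec (signedMean J)) ≤ 2 * M / k := by
  set A := signMatrix ε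
  -- Stacking `√M y` on `Ay` controls both errors at once; each signed basis vector contributes `M`
  -- to either part.
  let L : (Fin N → ℝ) →ₗ[ℝ] EuclideanSpace ℝ (Fin N ⊕ Fin M) :=
    (WithLp.linearEquiv 2 ℝ (Fin N ⊕ Fin M → ℝ)).symm.toLinearMap ∘ₗ
      LinearMap.pi (Sum.elim (fun j => √M • LinearMap.proj j)
        (fun i => LinearMap.proj i ∘ₗ A.mulVecLin))
  have hL : ∀ y, ‖L y‖ ^ 2 = M * l2Sq y + l2Sq (A.mulVec y) := by
    intro y
    rw [EuclideanSpace.norm_sq_eq]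
    simp [L, Fintype.sum_sum_type, l2Sq, mul_pow, Finset.mul_sum]
  have hmem : L x ∈ convexHull ℝ (Set.range fun a => L (signedBasis a)) := by
    choose b hb using exists_boolSign_mul_abs
    have e : x = ∑ j, |x j| • signedBasis (j, b (x j)) := by
      ext i
      simp only [signedBasis, Finset.sum_apply, Pi.smul_apply, Pi.single_apply, smul_eq_mul,
        mul_ite, mul_zero, Finset.sum_ite_eq, Finset.mem_univ, if_true]
      rw [mul_comm, hb]
    have e' : L x = ∑ j, |x j| • L (signedBasis (j, b (x j))) := by
      conv_lhs => rw [e]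
      simp
    rw [e']
    exact (convex_convexHull ℝ _).sum_mem (fun _ _ => abs_nonneg _) hx1
      fun j _ => subset_convexHull ℝ _ ⟨_, rfl⟩
  have hB : ∀ a, ‖L (signedBasis a)‖ ^ 2 ≤ 2 * M := by
    intro a
    rw [hL]
    simp [l2Sq, signedBasis, A, signMatrix, Matrix.mulVec_single, mul_pow, boolSign_sq,
      Pi.single_apply, ite_pow, Matrix.col]
    linarith
  obtain ⟨J, hJ⟩ := exists_sum_sub_norm_sq_le _ _ hmem _ hB k
  refine ⟨J, ?_⟩
  have hk' : (0 : ℝ) < k := by exact_mod_cast hk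
  have e1 : ∑ l, L (signedBasis (J l)) - (k : ℝ) • L x = (k : ℝ) • L (signedMean J - x) := by
    rw [← map_sum, ← map_smul, ← map_smul, ← map_sub, signedMean, smul_sub,
      smul_inv_smul₀ hk'.ne']
  rw [e1, norm_smul, mul_pow, hL, Matrix.mulVec_sub, hx, sub_zero, Real.norm_eq_abs, sq_abs] at hJ
  rw [le_div_iff₀ hk']
  have : (k : ℝ) * ((M * l2Sq (signedMean J - x) + l2Sq (A.mulVec (signedMean J))) * k) ≤
      k * (2 * M) := by linarith
  exact le_of_mul_le_mul_left this hk'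

/-! ### Random sign matrices have flat kernels -/

/-- Averaging over the first sign kills the odd powers, which gives both moments by induction. -/
theorem sum_sq_signs {N : ℕ} (z : Fin N → ℝ) :
    ∑ ε : Fin N → Bool, (∑ j, boolSign (ε j) * z j) ^ 2 = 2 ^ N * l2Sq z ∧
    ∑ ε : Fin N → Bool, (∑ j, boolSign (ε j) * z j) ^ 4 ≤ 2 ^ N * (3 * l2Sq z ^ 2) := by
  induction N with
  | zero => simp [l2Sq]
  | succ N ih =>
    obtain ⟨h2, h4⟩ := ih (fun j => z j.succ)
    have hs : ∀ f : (Fin (N + 1) → Bool) → ℝ, ∑ ε, f ε =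
        ∑ ε : Fin N → Bool, (f (Fin.cons true ε) + f (Fin.cons false ε)) := by
      intro f
      rw [← (Fin.consEquiv fun _ => Bool).sum_comp, Fintype.sum_prod_type, Fintype.sum_bool,
        ← Finset.sum_add_distrib]
      rfl
    have hq : l2Sq z = z 0 ^ 2 + l2Sq fun j => z j.succ := Fin.sum_univ_succ _
    set q := l2Sq fun j => z j.succ
    rw [hs, hs, hq]
    simp only [Fin.sum_univ_succ, Fin.cons_zero, Fin.cons_succ]
    simp only [boolSign, if_true, Bool.false_eq_true, if_false] at *
    set X : (Fin N → Bool) → ℝ := fun ε => ∑ j, (if ε j = true then 1 else -1) * z j.succ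
    change ∑ ε, X ε ^ 2 = _ at h2
    change ∑ ε, X ε ^ 4 ≤ _ at h4
    change ∑ ε, ((1 * z 0 + X ε) ^ 2 + (-1 * z 0 + X ε) ^ 2) = _ ∧
      ∑ ε, ((1 * z 0 + X ε) ^ 4 + (-1 * z 0 + X ε) ^ 4) ≤ _
    have hcard : ∑ _ε : Fin N → Bool, (1 : ℝ) = 2 ^ N := by simp
    constructor
    · have : ∀ ε, (1 * z 0 + X ε) ^ 2 + (-1 * z 0 + X ε) ^ 2 = 2 * z 0 ^ 2 * 1 + 2 * X ε ^ 2 :=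
        fun ε => by ring
      simp only [this, Finset.sum_add_distrib, ← Finset.mul_sum]
      rw [hcard, h2]
      ring
    · have : ∀ ε, (1 * z 0 + X ε) ^ 4 + (-1 * z 0 + X ε) ^ 4 =
          2 * z 0 ^ 4 * 1 + 12 * z 0 ^ 2 * X ε ^ 2 + 2 * X ε ^ 4 := fun ε => by ring
      simp only [this, Finset.sum_add_distrib, ← Finset.mul_sum]
      rw [hcard, h2]
      have : (0 : ℝ) ≤ 2 ^ N * z 0 ^ 4 := by positivity
      rw [pow_succ (2 : ℝ) N]
      nlinarith

theorem exp_neg_le_quadratic {x : ℝ} (hx : 0 ≤ x) : Real.exp (-x) ≤ 1 - x + x ^ 2 / 2 := by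
  rw [Real.exp_neg]
  have h := Real.quadratic_le_exp_of_nonneg hx
  have h0 : 0 < 1 + x + x ^ 2 / 2 := by positivity
  refine (inv_anti₀ h0 h).trans ?_
  rw [inv_le_iff_one_le_mul₀ h0]
  -- `(1 - x + x²/2)(1 + x + x²/2) = 1 + x⁴/4`.
  nlinarith [pow_nonneg hx 4]

/-- The first two terms average to `1 - 1/3`, and the fourth moment adds at most `3/18`. -/
theorem sum_exp_neg_sq_signs_le {N : ℕ} (z : Fin N → ℝ) (hz : 0 < l2Sq z) :
    ∑ ε : Fin N → Bool, Real.exp (-((∑ j, boolSign (ε j) * z j) ^ 2 / (3 * l2Sq z))) ≤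
      2 ^ N * (5 / 6) := by
  obtain ⟨h2, h4⟩ := sum_sq_signs z
  set q := l2Sq z
  have hcard : ∑ _ε : Fin N → Bool, (1 : ℝ) = 2 ^ N := by simp
  calc ∑ ε : Fin N → Bool, Real.exp (-((∑ j, boolSign (ε j) * z j) ^ 2 / (3 * q)))
      ≤ ∑ ε : Fin N → Bool, (1 - 1 / (3 * q) * (∑ j, boolSign (ε j) * z j) ^ 2 +
          1 / (18 * q ^ 2) * (∑ j, boolSign (ε j) * z j) ^ 4) := by
        refine Finset.sum_le_sum fun ε _ => (exp_neg_le_quadratic (by positivity)).trans_eq ?_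
        field_simp
        ring
    _ = 2 ^ N - 1 / (3 * q) * (2 ^ N * q) +
          1 / (18 * q ^ 2) * ∑ ε : Fin N → Bool, (∑ j, boolSign (ε j) * z j) ^ 4 := by
        rw [Finset.sum_add_distrib, Finset.sum_sub_distrib, ← Finset.mul_sum, ← Finset.mul_sum,
          h2, hcard]
    _ ≤ 2 ^ N - 1 / (3 * q) * (2 ^ N * q) + 1 / (18 * q ^ 2) * (2 ^ N * (3 * q ^ 2)) := by
        gcongr
    _ = 2 ^ N * (5 / 6) := by
        field_simp
        ring

/-- Few sign matrices shrink a given vector substantially. -/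
theorem card_signMatrix_shrinking_le {M N : ℕ} (z : Fin N → ℝ) (hz : 0 < l2Sq z) :
    ((Finset.univ.filter fun ε : Fin M → Fin N → Bool =>
      9 * l2Sq ((signMatrix ε).mulVec z) ≤ M * l2Sq z).card : ℝ) ≤
      (2 ^ N) ^ M * Real.exp (-(M / 9)) := by
  set q := l2Sq z with hq
  have hprod : ∑ ε : Fin M → Fin N → Bool,
      Real.exp (-(l2Sq ((signMatrix ε).mulVec z) / (3 * q))) ≤ (2 ^ N * (5 / 6)) ^ M := by
    have e : ∀ ε : Fin M → Fin N → Bool,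
        Real.exp (-(l2Sq ((signMatrix ε).mulVec z) / (3 * q))) =
        ∏ i, Real.exp (-((∑ j, boolSign (ε i j) * z j) ^ 2 / (3 * q))) := by
      intro ε
      rw [← Real.exp_sum, Finset.sum_neg_distrib, ← Finset.sum_div]
      rfl
    simp only [e]
    rw [← Fintype.piFinset_univ, ← Finset.prod_univ_sum
      (fun _ : Fin M => (Finset.univ : Finset (Fin N → Bool)))
      (fun _ (η : Fin N → Bool) => Real.exp (-((∑ j, boolSign (η j) * z j) ^ 2 / (3 * q)))),
      Finset.prod_const, Finset.card_univ, Fintype.card_fin]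
    exact pow_le_pow_left₀ (Finset.sum_nonneg fun _ _ => (Real.exp_pos _).le)
      (sum_exp_neg_sq_signs_le z hz) M
  -- Exponential Markov inequality; the numbers close because `5/6 ≤ exp(-4/27)` and `4/27 = 1/9 +
  -- 1/27`.
  have hmark : ((Finset.univ.filter fun ε : Fin M → Fin N → Bool =>
      9 * l2Sq ((signMatrix ε).mulVec z) ≤ M * q).card : ℝ) * Real.exp (-(M / 27)) ≤
      (2 ^ N * (5 / 6)) ^ M := by
    rw [← nsmul_eq_mul]
    refine le_trans (Finset.card_nsmul_le_sum _ _ _ fun ε hε => ?_) ((Finset.sum_le_univ_sum_of_nonneg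
      fun ε => (Real.exp_pos (-(l2Sq ((signMatrix ε).mulVec z) / (3 * q)))).le).trans hprod)
    simp only [Finset.mem_filter, Finset.mem_univ, true_and] at hε
    rw [Real.exp_le_exp, neg_le_neg_iff, div_le_div_iff₀ (by positivity) (by norm_num)]
    linarith
  have h56 : (5 / 6 : ℝ) ≤ Real.exp (-(4 / 27)) := by
    have := Real.add_one_le_exp (-(4 / 27) : ℝ)
    linarith
  have hfin : (2 ^ N * (5 / 6) : ℝ) ^ M ≤
      (2 ^ N) ^ M * Real.exp (-(M / 9)) * Real.exp (-(M / 27)) := by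
    rw [mul_pow, mul_assoc, ← Real.exp_add]
    have : Real.exp (-(M / 9 : ℝ) + -(M / 27)) = Real.exp (-(4 / 27)) ^ M := by
      rw [← Real.exp_nat_mul]
      congr 1
      ring
    rw [this]
    gcongr
  exact le_of_mul_le_mul_right (hmark.trans hfin) (Real.exp_pos _)

/-- Union bound over at most `(2N)^k` means, each bad for a fraction at most `exp(-M/9)` of the sign
matrices. -/
theorem exists_signMatrix_not_shrinking {M N k : ℕ} (hN : 0 < N)
    (hk : k * Real.log (2 * N) < M / 9) :
    ∃ ε : Fin M → Fin N → Bool, ∀ J : Fin k → Fin N × Bool, 0 < l2Sq (signedMean J) →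
      M * l2Sq (signedMean J) < 9 * l2Sq ((signMatrix ε).mulVec (signedMean J)) := by
  by_contra! hcon
  have hN' : (0 : ℝ) < N := by exact_mod_cast hN
  set P : Finset (Fin k → Fin N × Bool) := Finset.univ.filter fun J => 0 < l2Sq (signedMean J)
  have hsub : (Finset.univ : Finset (Fin M → Fin N → Bool)) ⊆ P.biUnion fun J =>
      Finset.univ.filter fun ε =>
        9 * l2Sq ((signMatrix ε).mulVec (signedMean J)) ≤ M * l2Sq (signedMean J) := by
    intro ε _
    obtain ⟨J, hJ, hJ'⟩ := hcon ε
    simp only [Finset.mem_biUnion, Finset.mem_filter, Finset.mem_univ, true_and, P]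
    exact ⟨J, hJ, hJ'⟩
  have h1 := (Finset.card_le_card hsub).trans Finset.card_biUnion_le
  have h2 : ((2 : ℝ) ^ N) ^ M ≤ (P.card : ℝ) * ((2 ^ N) ^ M * Real.exp (-(M / 9))) := by
    have h3 : (((Finset.univ : Finset (Fin M → Fin N → Bool)).card : ℕ) : ℝ) = (2 ^ N) ^ M := by
      simp
    rw [← h3]
    refine le_trans (Nat.cast_le.mpr h1) ?_
    rw [h3, ← nsmul_eq_mul]
    push_cast
    refine Finset.sum_le_card_nsmul _ _ _ fun J hJ => card_signMatrix_shrinking_le _ ?_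
    simpa [P] using hJ
  have h4 : (P.card : ℝ) ≤ Real.exp (k * Real.log (2 * N)) := by
    rw [Real.exp_nat_mul, Real.exp_log (by positivity)]
    have : P.card ≤ (N * 2) ^ k := by
      refine (Finset.card_le_univ _).trans_eq ?_
      simp
    have : (P.card : ℝ) ≤ ((N * 2) ^ k : ℕ) := by exact_mod_cast this
    refine this.trans_eq ?_
    push_cast
    ring
  have h5 : (P.card : ℝ) * Real.exp (-(M / 9)) < 1 := by
    calc (P.card : ℝ) * Real.exp (-(M / 9)) ≤
          Real.exp (k * Real.log (2 * N)) * Real.exp (-(M / 9)) := by gcongr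
      _ < 1 := by
          rw [← Real.exp_add, Real.exp_lt_one_iff]
          linarith
  have h6 : (0 : ℝ) < (2 ^ N) ^ M := by positivity
  nlinarith

/-- Sign matrices whose kernel vectors have small Euclidean norm compared with their `ℓ¹` norm. -/
theorem exists_matrix_ker_l2Sq_le {M N k : ℕ} {ρ : ℝ} (hρ : 0 < ρ) (hN : 0 < N) (hM : 0 < M)
    (hkρ : 32 ≤ k * ρ ^ 2) (hk : k * Real.log (2 * N) < M / 9) :
    ∃ Φ : Matrix (Fin M) (Fin N) ℝ, ∀ x ∈ nullSpace Φ,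
      l2Sq x ≤ ρ ^ 2 * l1On Finset.univ x ^ 2 := by
  obtain ⟨ε, hε⟩ := exists_signMatrix_not_shrinking hN hk
  refine ⟨signMatrix ε, ?_⟩
  have hk0 : 0 < k := by
    rcases Nat.eq_zero_or_pos k with rfl | h
    · norm_num at hkρ
    · exact h
  have hk' : (0 : ℝ) < k := by exact_mod_cast hk0
  have hM' : (0 : ℝ) < M := by exact_mod_cast hM
  have main : ∀ x : Fin N → ℝ, (signMatrix ε).mulVec x = 0 → l1On Finset.univ x = 1 →
      l2Sq x ≤ ρ ^ 2 := by
    intro x hx hx1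
    by_contra! hcon
    obtain ⟨J, hJ⟩ := exists_signedMean_approx hk0 ε x hx hx1
    set z := signedMean J
    have hb : 2 * M / k ≤ M * ρ ^ 2 / 16 := by
      rw [div_le_div_iff₀ hk' (by norm_num)]
      nlinarith
    have hy0 : 0 ≤ l2Sq ((signMatrix ε).mulVec z) :=
      Finset.sum_nonneg fun _ _ => sq_nonneg _
    have hd0 : 0 ≤ l2Sq (z - x) := Finset.sum_nonneg fun _ _ => sq_nonneg _
    have hd : l2Sq (z - x) ≤ ρ ^ 2 / 16 := by
      refine le_of_mul_le_mul_left ?_ hM'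
      linarith
    have hy : l2Sq ((signMatrix ε).mulVec z) ≤ M * ρ ^ 2 / 16 := by
      have := mul_nonneg hM'.le hd0
      linarith
    -- These weights give `‖z‖² > 9ρ²/16`, exactly what collides with `‖Az‖² ≤ Mρ²/16` and
    -- non-shrinking.
    have hxz : l2Sq x ≤ 4 / 3 * l2Sq z + 4 * l2Sq (z - x) := by
      simp only [l2Sq, Finset.mul_sum, ← Finset.sum_add_distrib]
      refine Finset.sum_le_sum fun i _ => ?_
      simp only [Pi.sub_apply]
      nlinarith [sq_nonneg (4 * z i - 3 * x i)]
    have hz : 9 / 16 * ρ ^ 2 < l2Sq z := by linarith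
    have := hε J (lt_trans (by positivity) hz)
    nlinarith
  intro x hx
  have hx' : (signMatrix ε).mulVec x = 0 := by simpa [nullSpace] using hx
  have hl0 : 0 ≤ l1On Finset.univ x := Finset.sum_nonneg fun _ _ => abs_nonneg _
  rcases hl0.eq_or_lt with h | h
  · have : x = 0 := by
      ext i
      have := (Finset.sum_eq_zero_iff_of_nonneg (fun i _ => abs_nonneg (x i))).mp h.symm i
        (Finset.mem_univ i)
      simpa using this
    simp [this, l2Sq, l1On]
  · set c := l1On Finset.univ x
    have := main (c⁻¹ • x) (by rw [Matrix.mulVec_smul, hx', smul_zero]) (by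
      simp only [l1On, Pi.smul_apply, smul_eq_mul, abs_mul, ← Finset.mul_sum]
      rw [abs_of_pos (inv_pos.mpr h)]
      exact inv_mul_cancel₀ h.ne')
    simp only [l2Sq, Pi.smul_apply, smul_eq_mul, mul_pow, ← Finset.mul_sum] at this
    rw [inv_pow, inv_mul_le_iff₀ (by positivity)] at this
    rw [mul_comm]
    exact this


/-! ### Creating a dominant kernel entry -/

theorem exists_ne_zero_mem_nullSpace {M N : ℕ} (hMN : M < N) (Φ : Matrix (Fin M) (Fin N) ℝ) :
    ∃ h ∈ nullSpace Φ, h ≠ 0 := by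
  have := LinearMap.ker_ne_bot_of_finrank_lt (f := Φ.mulVecLin) (by simpa using hMN)
  obtain ⟨h, hh, h0⟩ := Submodule.exists_mem_ne_zero_of_ne_bot this
  exact ⟨h, hh, h0⟩

/-- Rescaling one coordinate by `t` rescales that coordinate of the kernel. -/
theorem exists_matrix_nullSpace_rescaled {M N : ℕ} (Φ : Matrix (Fin M) (Fin N) ℝ) (i : Fin N)
    {t : ℝ} (ht : t ≠ 0) :
    ∃ Ψ : Matrix (Fin M) (Fin N) ℝ, ∀ v, v ∈ nullSpace Ψ ↔
      ∃ h ∈ nullSpace Φ, v = Function.update h i (t * h i) := by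
  have hmul : ∀ v : Fin N → ℝ, (Φ.updateCol i (t⁻¹ • Φ.col i)).mulVec v =
      Φ.mulVec (Function.update v i (t⁻¹ * v i)) := by
    intro v
    ext r
    simp only [Matrix.mulVec, dotProduct]
    refine Finset.sum_congr rfl fun j _ => ?_
    by_cases hj : j = i
    · subst hj
      simp [Matrix.col]
      ring
    · simp [hj]
  refine ⟨Φ.updateCol i (t⁻¹ • Φ.col i), fun v => ?_⟩
  rw [mem_nullSpace, hmul]
  constructor
  · intro h
    refine ⟨_, mem_nullSpace.mpr h, ?_⟩
    simp [mul_inv_cancel_left₀ ht]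
  · rintro ⟨h, hh, rfl⟩
    simpa [inv_mul_cancel_left₀ ht] using mem_nullSpace.mp hh

theorem l1On_update_of_notMem {N : ℕ} {T : Finset (Fin N)} {i : Fin N} (hi : i ∉ T)
    (v : Fin N → ℝ) (x : ℝ) : l1On T (Function.update v i x) = l1On T v :=
  Finset.sum_congr rfl fun j hj => by
    rw [Function.update_of_ne (ne_of_mem_of_not_mem hj hi)]

theorem l1On_eq_add_erase {N : ℕ} {T : Finset (Fin N)} {i : Fin N} (hi : i ∈ T)
    (v : Fin N → ℝ) : l1On T v = |v i| + l1On (T.erase i) v :=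
  (Finset.add_sum_erase T _ hi).symm

/-- A null space with a flat `ℓ¹` bound can be rescaled in one coordinate so that it keeps the
null space property but contains a vector with one dominant entry. -/
theorem exists_hasNSPWith_peaked {M N s : ℕ} (hs : 0 < s) {γ : ℝ} (hγ0 : 0 < γ) (hγ1 : γ < 1)
    (hMN : M < N) (Φ : Matrix (Fin M) (Fin N) ℝ)
    (hΦ : ∀ h ∈ nullSpace Φ, ∀ T : Finset (Fin N), T.card ≤ s →
      l1On T h ≤ γ / 10 * l1On Finset.univ h) :
    ∃ Ψ : Matrix (Fin M) (Fin N) ℝ, HasNSPWith Ψ s γ ∧ ∃ v ∈ nullSpace Ψ, ∃ i,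
      0 < l1On (Finset.univ.erase i) v ∧ γ / 4 * l1On (Finset.univ.erase i) v ≤ |v i| := by
  obtain ⟨h₀, hh₀, hne⟩ := exists_ne_zero_mem_nullSpace hMN Φ
  obtain ⟨i, hi⟩ : ∃ i, h₀ i ≠ 0 := Function.ne_iff.mp hne
  set a : (Fin N → ℝ) → ℝ := fun h => l1On (Finset.univ.erase i) h with ha
  have ha0 : ∀ h, 0 ≤ a h := fun h => l1On_nonneg _ h
  have huniv : ∀ h, l1On Finset.univ h = |h i| + a h :=
    fun h => l1On_eq_add_erase (Finset.mem_univ i) h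
  have hsmall : ∀ h ∈ nullSpace Φ, ∀ T : Finset (Fin N), T.card ≤ s →
      l1On T h ≤ γ / 9 * a h := by
    intro h hh T hT
    have h1 := hΦ h hh {i} (by simpa using Nat.succ_le_of_lt hs)
    have h2 := hΦ h hh T hT
    rw [huniv] at h1 h2
    simp only [l1On, Finset.sum_singleton] at h1
    have : 9 / 10 * |h i| ≤ γ / 10 * a h := by nlinarith [abs_nonneg (h i)]
    have hb : |h i| ≤ a h / 9 := by nlinarith [ha0 h]
    have := mul_le_mul_of_nonneg_left hb hγ0.le
    linarith
  have hpk : ∀ h ∈ nullSpace Φ, |h i| ≤ γ / 9 * a h := by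
    intro h hh
    simpa [l1On] using hsmall h hh {i} (by simpa using Nat.succ_le_of_lt hs)
  have hapos : ∀ h ∈ nullSpace Φ, h i ≠ 0 → 0 < a h := by
    intro h hh hhi
    have := (abs_pos.mpr hhi).trans_le (hpk h hh)
    exact pos_of_mul_pos_right this (by positivity)
  set R : Set ℝ := {r | ∃ h ∈ nullSpace Φ, 0 < a h ∧ r = |h i| / a h} with hR
  have hbdd : BddAbove R := by
    refine ⟨γ / 9, ?_⟩
    rintro _ ⟨h, hh, h0, rfl⟩
    rw [div_le_iff₀ h0]
    exact hpk h hh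
  have hmem₀ : |h₀ i| / a h₀ ∈ R := ⟨h₀, hh₀, hapos h₀ hh₀ hi, rfl⟩
  set κ := sSup R
  have hκ : 0 < κ :=
    (div_pos (abs_pos.mpr hi) (hapos h₀ hh₀ hi)).trans_le (le_csSup hbdd hmem₀)
  -- A near-maximizer within a factor `2` suffices, so attainment of the supremum is not needed.
  obtain ⟨_, ⟨h₁, hh₁, ha₁, rfl⟩, hlt⟩ := exists_lt_of_lt_csSup ⟨_, hmem₀⟩ (half_lt_self hκ)
  have hκle : ∀ h ∈ nullSpace Φ, |h i| ≤ κ * a h := by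
    intro h hh
    by_cases h0 : h i = 0
    · rw [h0, abs_zero]
      exact mul_nonneg hκ.le (ha0 h)
    · have h1 := hapos h hh h0
      rw [← div_le_iff₀ h1]
      exact le_csSup hbdd ⟨h, hh, h1, rfl⟩
  -- Makes the supremal ratio of entry `i` to the rest `γ/2`. NSP survives since `γ/2 + (1 + γ)γ/9 ≤
  -- γ`, and `h₁` keeps ratio at least `γ/4`.
  set t := γ / (2 * κ) with ht
  have ht0 : 0 < t := by positivity
  have htκ : t * κ = γ / 2 := by rw [ht]; field_simp
  obtain ⟨Ψ, hΨ⟩ := exists_matrix_nullSpace_rescaled Φ i ht0.ne'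
  have hup : ∀ h : Fin N → ℝ, a (Function.update h i (t * h i)) = a h := fun h =>
    l1On_update_of_notMem (Finset.notMem_erase i _) h _
  refine ⟨Ψ, ?_, Function.update h₁ i (t * h₁ i), (hΨ _).mpr ⟨h₁, hh₁, rfl⟩, i, ?_, ?_⟩
  · intro v hv T hT
    obtain ⟨h, hh, rfl⟩ := (hΨ v).mp hv
    by_cases hiT : i ∈ T
    · have e1 : l1On T (Function.update h i (t * h i)) = t * |h i| + l1On (T.erase i) h := by
        rw [l1On_eq_add_erase hiT, l1On_update_of_notMem (Finset.notMem_erase i _),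
          Function.update_self, abs_mul, abs_of_pos ht0]
      have e2 : l1On Tᶜ (Function.update h i (t * h i)) = l1On Tᶜ h :=
        l1On_update_of_notMem (by simpa using hiT) _ _
      have e3 : l1On (T.erase i) h + l1On Tᶜ h = a h := by
        have h1 := l1On_add_compl T h
        rw [huniv, l1On_eq_add_erase hiT] at h1
        linarith
      have h2 := hsmall h hh (T.erase i) ((Finset.card_erase_le).trans hT)
      have h3 : t * |h i| ≤ γ / 2 * a h := by
        rw [← htκ, mul_assoc]
        exact mul_le_mul_of_nonneg_left (hκle h hh) ht0.le
      rw [e1, e2]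
      nlinarith [ha0 h, l1On_nonneg (T.erase i) h]
    · have e1 : l1On T (Function.update h i (t * h i)) = l1On T h :=
        l1On_update_of_notMem hiT _ _
      have h2 := hsmall h hh T hT
      have h3 := l1On_add_compl T (Function.update h i (t * h i))
      have h4 : l1On Finset.univ (Function.update h i (t * h i)) =
          |Function.update h i (t * h i) i| + a h := by
        rw [l1On_eq_add_erase (Finset.mem_univ i)]
        exact congrArg _ (hup h)
      have h5 := abs_nonneg (Function.update h i (t * h i) i)
      rw [e1] at h3 ⊢
      nlinarith [ha0 h, l1On_nonneg T h]
  · change 0 < a _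
    rwa [hup]
  · change γ / 4 * a _ ≤ _
    rw [hup, Function.update_self, abs_mul, abs_of_pos ht0]
    rw [lt_div_iff₀ ha₁] at hlt
    have := mul_le_mul_of_nonneg_left hlt.le ht0.le
    have e : t * (κ / 2 * a h₁) = γ / 4 * a h₁ := by
      linear_combination (a h₁ / 2) * htκ
    linarith

/-! ### Separating NSP from RIP-NSP -/

/-- RIP-NSP limits how dominant a single entry of a kernel vector can be. -/
theorem HasRIPNSP.sq_entry_le {M N s : ℕ} {Φ : Matrix (Fin M) (Fin N) ℝ} {δ : ℝ}
    (hs : 0 < s) (hδ0 : 0 ≤ δ) (hδ1 : δ < 1) (hΦ : HasRIPNSP Φ (2 * s) δ) {v : Fin N → ℝ}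
    (hv : v ∈ nullSpace Φ) (i : Fin N) :
    2 * (1 - δ) * s * |v i| ^ 2 ≤ δ * l1On (Finset.univ.erase i) v ^ 2 := by
  obtain ⟨p, A, hker, hA⟩ := hΦ
  rw [← hker] at hv
  have hs' : (0 : ℝ) < s := by exact_mod_cast hs
  -- One slot of the head is reserved for `i`. An entry outside the head, together with the `s - 1`
  -- top ones, still yields `s |v j| ≤ a`.
  obtain ⟨T, hTsub, hT, -, htop⟩ := exists_top_entries (Finset.univ.erase i) (s - 1) v
  have hiT : i ∉ T := fun h => Finset.notMem_erase i _ (hTsub h)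
  set a := l1On (Finset.univ.erase i) v
  have hcard : (insert i T).card ≤ s := by
    rw [Finset.card_insert_of_notMem hiT]
    omega
  obtain ⟨U, hU0, hU, hμ⟩ := hA.exists_tail_energy hv hcard (α := a / s)
    (div_nonneg (l1On_nonneg _ _) hs'.le)
    (fun j hj => by
      simp only [Finset.mem_insert, not_or] at hj
      rw [le_div_iff₀ hs']
      have h1 := htop j (Finset.mem_erase.mpr ⟨hj.1, Finset.mem_univ j⟩) hj.2
      rw [Nat.cast_sub hs, Nat.cast_one] at h1
      have h2 : |v j| + l1On T v ≤ a := by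
        have : l1On (insert j T) v ≤ a := l1On_mono
          (Finset.insert_subset (Finset.mem_erase.mpr ⟨hj.1, Finset.mem_univ j⟩) hTsub) v
        rwa [l1On, Finset.sum_insert hj.2] at this
      linarith)
    (by
      rw [mul_div_cancel₀ _ hs'.ne']
      refine l1On_mono (fun j hj => ?_) v
      simp only [Finset.compl_insert, Finset.mem_erase] at hj
      exact Finset.mem_erase.mpr ⟨hj.1, Finset.mem_univ j⟩)
  -- Here the head disappears from the right-hand side, leaving `2(1-δ)X ≤ δU`.
  have key := hμ (1 / 2) (by norm_num) (by norm_num)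
  have hX : |v i| ^ 2 ≤ l2Sq (restrict (insert i T) v) := by
    rw [l2Sq_restrict, sq_abs]
    exact Finset.single_le_sum (f := fun j => v j ^ 2) (fun _ _ => sq_nonneg _)
      (Finset.mem_insert_self i T)
  have hU' : s * U ≤ a ^ 2 := by
    have := mul_le_mul_of_nonneg_left hU hs'.le
    have e : (s : ℝ) * (s * (a / s) ^ 2) = a ^ 2 := by field_simp
    linarith
  set X := l2Sq (restrict (insert i T) v)
  have k1 : 2 * (1 - δ) * X ≤ δ * U := by linarith
  calc 2 * (1 - δ) * s * |v i| ^ 2 = s * (2 * (1 - δ) * |v i| ^ 2) := by ring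
    _ ≤ s * (2 * (1 - δ) * X) := by
        have : 0 ≤ 1 - δ := by linarith
        gcongr
    _ ≤ s * (δ * U) := by gcongr
    _ = δ * (s * U) := by ring
    _ ≤ δ * a ^ 2 := by gcongr

theorem exists_hasNSPWith_not_hasRIPNSP {γ δ : ℝ} (hγ0 : 0 < γ) (hγ1 : γ < 1) (hδ0 : 0 ≤ δ)
    (hδ : δ < 1 / √2) {M N s : ℕ} (hMN : (M : ℝ) ≤ N / 2)
    (hM : 2 * measurementConst 2000 (γ / 3) * s * Real.log N ^ 4 ≤ M)
    (hNs : 11 ≤ (N : ℝ) / s)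
    (hsγ : 640 * (1 + δ) ^ 2 / ((1 - √2 * δ) ^ 2 * γ ^ 2) ≤ s) :
    ∃ Φ : Matrix (Fin M) (Fin N) ℝ, HasNSPWith Φ s γ ∧ ¬ HasRIPNSP Φ (2 * s) δ := by
  have h2 : √2 ^ 2 = 2 := Real.sq_sqrt (by norm_num)
  have h21 : 1.4 < √2 := by nlinarith [Real.sqrt_nonneg 2]
  rw [lt_div_iff₀ (by positivity)] at hδ
  have hδ' : δ < 5 / 7 := by nlinarith
  have hs640 : 640 ≤ s * γ ^ 2 := by
    have hd : 0 < 1 - √2 * δ := by linarith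
    rw [div_le_iff₀ (by positivity)] at hsγ
    have h1 : (1 - √2 * δ) ^ 2 ≤ 1 := pow_le_one₀ hd.le (by nlinarith)
    have h3 : (s : ℝ) * ((1 - √2 * δ) ^ 2 * γ ^ 2) ≤ s * (1 * γ ^ 2) := by gcongr
    nlinarith
  have hs' : (0 : ℝ) < s := by
    by_contra! h
    nlinarith [sq_nonneg γ]
  have hs : 0 < s := by exact_mod_cast hs'
  have hs1 : (640 : ℝ) ≤ s := by
    have : (s : ℝ) * γ ^ 2 ≤ s * 1 := by
      gcongr
      exact pow_le_one₀ hγ0.le hγ1.le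
    linarith
  rw [le_div_iff₀ hs'] at hNs
  have hN3 : (7000 : ℝ) ≤ N := by linarith
  have hN' : (0 : ℝ) < N := by linarith
  have hN : 0 < N := by exact_mod_cast hN'
  have hlog1 : 1 ≤ Real.log N := by
    rw [Real.le_log_iff_exp_le hN']
    linarith [Real.exp_one_lt_d9]
  have hlog2 : Real.log (2 * N) ≤ 2 * Real.log N := by
    rw [two_mul (Real.log N), ← Real.log_mul hN'.ne' hN'.ne']
    exact Real.log_le_log (by positivity) (by nlinarith)
  -- `72000 = 2 · 2000 · 18`, and `72000/9 = 8000` exceeds the `2 · 3201` coming from the union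
  -- bound below.
  have hMbig : 72000 * (s / γ ^ 2) * Real.log N ≤ M := by
    refine le_trans ?_ hM
    have h3 : 18 / γ ^ 2 ≤ ((√2 + γ / 3) / (γ / 3)) ^ 2 := by
      rw [div_pow, div_le_div_iff₀ (by positivity) (by positivity)]
      have : 2 ≤ (√2 + γ / 3) ^ 2 := by nlinarith
      nlinarith [sq_nonneg γ]
    have h4 : Real.log N ≤ Real.log N ^ 4 := le_self_pow₀ hlog1 (by norm_num)
    calc 72000 * (s / γ ^ 2) * Real.log N = 2 * (2000 * (18 / γ ^ 2)) * s * Real.log N := by ring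
      _ ≤ 2 * measurementConst 2000 (γ / 3) * s * Real.log N ^ 4 := by
          unfold measurementConst
          gcongr
  have hMpos : (0 : ℝ) < M := lt_of_lt_of_le (by positivity) hMbig
  have hM0 : 0 < M := by exact_mod_cast hMpos
  have hMN' : M < N := by
    have : (M : ℝ) < N := by linarith
    exact_mod_cast this
  set ρ := γ / 10 / √s with hρdef
  have hρ : 0 < ρ := by positivity
  have hρ2 : ρ ^ 2 = γ ^ 2 / (100 * s) := by
    rw [hρdef, div_pow, div_pow, Real.sq_sqrt hs'.le]
    field_simp
    norm_num
  -- As `ρ² = γ²/(100 s)`, this `k` is the least natural number with `k ρ² ≥ 32`.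
  obtain ⟨Φ, hΦ⟩ := exists_matrix_ker_l2Sq_le (M := M) (N := N)
    (k := ⌈3200 * (s / γ ^ 2)⌉₊) hρ hN hM0
    (by
      have := Nat.le_ceil (3200 * ((s : ℝ) / γ ^ 2))
      calc (32 : ℝ) = 3200 * (s / γ ^ 2) * ρ ^ 2 := by
            rw [hρ2]
            field_simp
            norm_num
        _ ≤ _ := by gcongr)
    (by
      have h3 := Nat.ceil_lt_add_one (show 0 ≤ 3200 * ((s : ℝ) / γ ^ 2) by positivity)
      have h4 : 1 ≤ (s : ℝ) / γ ^ 2 := by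
        rw [le_div_iff₀ (by positivity)]
        have : γ ^ 2 ≤ 1 := pow_le_one₀ hγ0.le hγ1.le
        linarith
      have h5 : 0 ≤ Real.log (2 * N) := Real.log_nonneg (by linarith)
      calc (⌈3200 * ((s : ℝ) / γ ^ 2)⌉₊ : ℝ) * Real.log (2 * N)
          ≤ (3201 * (s / γ ^ 2)) * (2 * Real.log N) := by
            gcongr
            linarith
        _ < M / 9 := by
            have : 0 < (s / γ ^ 2) * Real.log N := by positivity
            linarith)
  have hflat : ∀ h ∈ nullSpace Φ, ∀ T : Finset (Fin N), T.card ≤ s →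
      l1On T h ≤ γ / 10 * l1On Finset.univ h := by
    intro h hh T hT
    have h1 := l1On_sq_le hT h
    have h3 : l2Sq (restrict T h) ≤ l2Sq h := by
      rw [l2Sq_restrict]
      exact Finset.sum_le_univ_sum_of_nonneg fun _ => sq_nonneg _
    have h4 := hΦ h hh
    refine le_of_sq_le_sq ?_ (mul_nonneg (by positivity) (l1On_nonneg _ _))
    calc l1On T h ^ 2 ≤ s * (ρ ^ 2 * l1On Finset.univ h ^ 2) :=
          h1.trans (mul_le_mul_of_nonneg_left (h3.trans h4) hs'.le)
      _ = (γ / 10 * l1On Finset.univ h) ^ 2 := by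
          rw [hρ2]
          field_simp
          ring
  obtain ⟨Ψ, hΨ, v, hv, i, ha, hvi⟩ := exists_hasNSPWith_peaked hs hγ0 hγ1 hMN' Φ hflat
  refine ⟨Ψ, hΨ, fun hrip => ?_⟩
  have key := hrip.sq_entry_le hs hδ0 (by linarith) hv i
  set a := l1On (Finset.univ.erase i) v
  have h3 : (γ / 4 * a) ^ 2 ≤ |v i| ^ 2 := pow_le_pow_left₀ (by positivity) hvi 2
  -- This forces `s γ² ≤ 20`, against `s γ² ≥ 640`.
  have h4 : 4 / 7 * s * (γ / 4 * a) ^ 2 ≤ 5 / 7 * a ^ 2 := by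
    calc 4 / 7 * s * (γ / 4 * a) ^ 2 ≤ 2 * (1 - δ) * s * |v i| ^ 2 := by
          refine mul_le_mul ?_ h3 (sq_nonneg _) (mul_nonneg (by linarith) hs'.le)
          exact mul_le_mul_of_nonneg_right (by linarith) hs'.le
      _ ≤ δ * a ^ 2 := key
      _ ≤ 5 / 7 * a ^ 2 := by gcongr
  have h5 : 640 * a ^ 2 ≤ s * γ ^ 2 * a ^ 2 := by gcongr
  have h6 : 0 < a ^ 2 := by positivity
  nlinarith

end CompressedSensing

theorem mainTheorem2 :
    (∃ K : ℝ, 0 < K ∧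
      ∀ γ δ : ℝ, 0 < γ → γ < 1 → 0 ≤ δ → δ < 1 / √2 →
      ∀ M N s : ℕ,
        (M : ℝ) ≤ (N : ℝ) / 2 →
        2 * CompressedSensing.measurementConst K (γ / 3) * (s : ℝ) * Real.log (N : ℝ) ^ 4
          ≤ (M : ℝ) →
        11 ≤ (N : ℝ) / (s : ℝ) →
        640 * (1 + δ) ^ 2 / ((1 - √2 * δ) ^ 2 * γ ^ 2) ≤ (s : ℝ) →
        ∃ Φ : Matrix (Fin M) (Fin N) ℝ,
          CompressedSensing.HasNSPWith Φ s γ ∧ ¬ CompressedSensing.HasRIPNSP Φ (2 * s) δ) ∧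
    (∀ (δ : ℝ), 0 ≤ δ → δ < 1 / √2 →
      ∀ (M N s : ℕ) (Φ : Matrix (Fin M) (Fin N) ℝ),
        CompressedSensing.HasRIPNSP Φ (2 * s) δ → CompressedSensing.HasNSP Φ s) :=
  ⟨⟨2000, by norm_num, fun _ _ hγ0 hγ1 hδ0 hδ _ _ _ hMN hM hNs hs =>
    CompressedSensing.exists_hasNSPWith_not_hasRIPNSP hγ0 hγ1 hδ0 hδ hMN hM hNs hs⟩,
    fun _ hδ0 hδ _ _ _ _ hΦ => hΦ.hasNSP hδ0 hδ⟩
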